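/- Let $k$ be a field (of any characteristic) and $n\ge 0$. For a ring $A$ with a derivation $d$, let $A((\partial^{-1}))$ be the ring of formal expressions $\sum_{i\le m} a_i\partial^i$ ($m\in\mathbf Z$, $a_i\in A$) with the product $$\Big(\sum_i a_i\partial^i\Big)\Big(\sum_j b_j\partial^j\Big)=\sum_{i,j;\,l\ge 0}\binom{i}{l}a_i\,d^l(b_j)\,\partial^{i+j-l}.$$ Let $P=k((x_1))\dots((x_n))((\partial_1^{-1}))\dots((\partial_n^{-1}))$ be the ring obtained from the field of iterated Laurent series $k((x_1))\dots((x_n))$ by adjoining successively $\partial_1,\dots,\partial_n$ in this way, where $\partial_i$ corresponds to the derivation $\partial/\partial x_i$, extended coefficientwise. Let $V=k((x_1))\dots((x_n))((z_1^{-1}))\dots((z_n^{-1}))$ be the field of iterated Laurent series, and let the symbol of $L=\sum_\beta a_\beta\,\partial_1^{\beta_1}\dots\partial_n^{\beta_n}\in P$, with $a_\beta\in k((x_1))\dots((x_n))$, be $\sigma(L)=\sum_\beta a_\beta\, z_1^{\beta_1}\dots z_n^{\beta_n}\in V$. Let $\mathrm{res}_P(L)\in k$ be the coefficient of $x_1^{-1}\dots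 x_n^{-1}\partial_1^{-1}\dots\partial_n^{-1}$ in $L\in P$, let $\mathrm{res}_V(F)\in k$ be the coefficient of $x_1^{-1}\dots x_n^{-1}z_1^{-1}\dots z_n^{-1}$ in $F\in V$, and put $\langle L,M\rangle=\mathrm{res}_P(LM)$ for $L,M\in P$. Then: i) $\mathrm{res}_P$ is a $k$-linear form on $P$, and $\mathrm{res}_P(L)=\mathrm{res}_V(\sigma(L))$ for all $L\in P$; ii) $\mathrm{res}_P(LM-ML)=0$ for all $L,M\in P$; iii) $\langle\cdot,\cdot\rangle$ is a nondegenerate $k$-bilinear form on $P$: it is $k$-bilinear, if $\langle L,M\rangle=0$ for all $M\in P$ then $L=0$, and if $\langle L,M\rangle=0$ for all $L\in P$ then $M=0$. -/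

import Mathlib

universe u

/-! ### Iterated Laurent series -/

/-- Iterated series in `n` variables over `A`, indexed by the exponents in `Γ`; the first variable
is adjoined first (it is the innermost one), the last variable is adjoined last.
* `IterHahn ℤ n A` is `A((x₁))…((xₙ))`: all exponents are bounded below at each stage.
* `IterHahn ℤᵒᵈ n A` is `A((z₁⁻¹))…((zₙ⁻¹))`: the exponents of `zᵢ` are integers with the opposite
  order, so they are bounded above at each stage. -/
def IterHahn (Γ : Type) [LinearOrder Γ] : ℕ → (A : Type u) → [Zero A] → Type u
  | 0, A, _ => A
  | n + 1, A, _ => IterHahn Γ n (HahnSeries Γ A)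

namespace IterHahn

variable {Γ : Type}

/-- Iterated series over a field form a field, with the usual (commutative) product of series. -/
noncomputable instance instField [AddCommGroup Γ] [LinearOrder Γ] [IsOrderedAddMonoid Γ] :
    (n : ℕ) → (A : Type u) → [Field A] → Field (IterHahn Γ n A)
  | 0, _, inst => inst
  | n + 1, A, _ => instField n (HahnSeries Γ A)

/-- The coefficientwise structure of a vector space over the field of constants. -/
noncomputable instance instModule [AddCommGroup Γ] [LinearOrder Γ] [IsOrderedAddMonoid Γ]
    (k : Type u) [Field k] :
    (n : ℕ) → (A : Type u) → [Field A] → [Module k A] → Module k (IterHahn Γ n A)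
  | 0, _, _, inst => inst
  | n + 1, A, _, _ => instModule k n (HahnSeries Γ A)

/-- `coeff n A f α` is the coefficient of `x₁ ^ α₁ ⋯ xₙ ^ αₙ` in `f`. -/
def coeff [LinearOrder Γ] :
    (n : ℕ) → (A : Type u) → [Zero A] → IterHahn Γ n A → (Fin n → Γ) → A
  | 0, _, _, f, _ => f
  | n + 1, A, _, f, α =>
      HahnSeries.coeff (coeff n (HahnSeries Γ A) f (Fin.tail α)) (α 0)

end IterHahn

/-- Applying an additive map to every coefficient of a one-variable series. -/
noncomputable def HahnSeries.mapHom {Γ : Type} [LinearOrder Γ] {A B : Type u} [AddCommGroup A]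
    [AddCommGroup B] (f : A →+ B) : HahnSeries Γ A →+ HahnSeries Γ B where
  toFun x := x.map f
  map_zero' := by ext; simp
  map_add' x y := HahnSeries.map_add f

namespace IterHahn

/-- Applying an additive map to every coefficient of an iterated Laurent series. -/
noncomputable def map : (n : ℕ) → {A B : Type u} → [Field A] → [Field B] → (A →+ B) →
    (IterHahn ℤ n A →+ IterHahn ℤ n B)
  | 0, _, _, _, _, f => f
  | n + 1, _, _, _, _, f => map n (HahnSeries.mapHom f)

/-- `pderiv n A i` is the partial derivative `∂/∂xᵢ` of `A((x₁))…((xₙ))`. -/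
noncomputable def pderiv : (n : ℕ) → (A : Type u) → [Field A] → Fin n →
    (IterHahn ℤ n A →+ IterHahn ℤ n A)
  | 0, _, _ => fun i => i.elim0
  | n + 1, A, _ =>
      Fin.cases (map n (LaurentSeries.derivative A (V := A)).toAddMonoidHom)
        (fun i => pderiv n (HahnSeries ℤ A) i)

end IterHahn

/-! ### Pseudo-differential operators in one variable -/

/-- The pseudo-differential operators `A((∂⁻¹))`: formal expressions `∑ aᵢ ∂ⁱ`, `i ∈ ℤ`, with
`aᵢ ∈ A` and `aᵢ = 0` for all large `i`. The map `d` enters only through the product. -/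
def PDO (A : Type u) [NonUnitalNonAssocRing A] (_d : A →+ A) : Type u := HahnSeries ℤᵒᵈ A

namespace PDO

variable {A : Type u} [NonUnitalNonAssocRing A] {d : A →+ A}

noncomputable instance : AddCommGroup (PDO A d) :=
  inferInstanceAs (AddCommGroup (HahnSeries ℤᵒᵈ A))

noncomputable instance {k : Type u} [Field k] [Module k A] : Module k (PDO A d) :=
  inferInstanceAs (Module k (HahnSeries ℤᵒᵈ A))

/-- The coefficient of `∂ⁱ`. -/
def coeff (L : PDO A d) (i : ℤ) : A := HahnSeries.coeff L (OrderDual.toDual i)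

@[ext] theorem ext {L M : PDO A d} (h : ∀ i, L.coeff i = M.coeff i) : L = M :=
  HahnSeries.ext (funext h)

@[simp] theorem coeff_zero (i : ℤ) : (0 : PDO A d).coeff i = 0 := rfl

@[simp] theorem coeff_add (L M : PDO A d) (i : ℤ) :
    (L + M).coeff i = L.coeff i + M.coeff i := rfl

@[simp] theorem coeff_smul {k : Type u} [Field k] [Module k A] (c : k) (L : PDO A d) (i : ℤ) :
    (c • L).coeff i = c • L.coeff i := rfl

theorem exists_bound (L : PDO A d) : ∃ N : ℤ, ∀ i, N < i → L.coeff i = 0 :=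
  ⟨OrderDual.ofDual (HahnSeries.order (Γ := ℤᵒᵈ) L), fun _ hi =>
    HahnSeries.coeff_eq_zero_of_lt_order (Γ := ℤᵒᵈ) hi⟩

/-- An operator from its sequence of coefficients. -/
def mk (f : ℤ → A) (hf : ∃ N : ℤ, ∀ i, N < i → f i = 0) : PDO A d :=
  HahnSeries.ofSuppBddBelow (Γ := ℤᵒᵈ) (fun i => f (OrderDual.ofDual i)) (by
    obtain ⟨N, hN⟩ := hf
    refine ⟨OrderDual.toDual N, fun i hi => ?_⟩
    by_contra h
    exact hi (hN _ (not_le.mp h)))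

@[simp] theorem coeff_mk (f : ℤ → A) (hf) (i : ℤ) : (mk f hf : PDO A d).coeff i = f i := rfl

/-- The contribution of `a_i ∂^i`, of `b_j ∂^j` with `j = m - i + k`, and of the `k`-th term of the
Leibniz rule to the coefficient of `∂^m = ∂^(i + j - k)` in a product: `(i choose k) a_i d^k(b_j)`.
The first entry of the pair is `i`, the second one is `k`. -/
noncomputable def mulTerm (L M : PDO A d) (m : ℤ) (p : ℤ × ℕ) : A :=
  Ring.choose p.1 p.2 • (L.coeff p.1 * d^[p.2] (M.coeff (m - p.1 + p.2)))

theorem mulTerm_eq_zero {L M : PDO A d} {m : ℤ} {p : ℤ × ℕ} {N N' : ℤ}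
    (hN : ∀ i, N < i → L.coeff i = 0) (hN' : ∀ i, N' < i → M.coeff i = 0)
    (h : N < p.1 ∨ N' < m - p.1 + p.2) : mulTerm L M m p = 0 := by
  unfold mulTerm
  rcases h with h | h
  · simp [hN _ h]
  · simp [hN' _ h, iterate_map_zero]

theorem finite_mulTerm (L M : PDO A d) (m : ℤ) : (mulTerm L M m).support.Finite := by
  obtain ⟨N, hN⟩ := L.exists_bound
  obtain ⟨N', hN'⟩ := M.exists_bound
  refine ((Set.finite_Icc (m - N') N).prod (Set.finite_Iic (N + N' - m).toNat)).subset ?_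
  rintro ⟨i, k⟩ hp
  have h1 : ¬ (N < i ∨ N' < m - i + k) := fun h => hp (mulTerm_eq_zero hN hN' h)
  simp only [Set.mem_prod, Set.mem_Icc, Set.mem_Iic]
  omega

/-- The product `(∑ a_i ∂^i) (∑ b_j ∂^j) = ∑_{i, j, k ≥ 0} (i choose k) a_i d^k(b_j) ∂^(i + j - k)`;
each coefficient is a finite sum by `finite_mulTerm`. -/
noncomputable instance : Mul (PDO A d) where
  mul L M := mk (fun m => ∑ᶠ p : ℤ × ℕ, mulTerm L M m p) (by
    obtain ⟨N, hN⟩ := L.exists_bound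
    obtain ⟨N', hN'⟩ := M.exists_bound
    refine ⟨N + N', fun m hm => ?_⟩
    rw [← finsum_zero (α := ℤ × ℕ)]
    exact finsum_congr fun p => mulTerm_eq_zero hN hN' (by omega))

theorem coeff_mul (L M : PDO A d) (m : ℤ) :
    (L * M).coeff m = ∑ᶠ p : ℤ × ℕ,
      Ring.choose p.1 p.2 • (L.coeff p.1 * d^[p.2] (M.coeff (m - p.1 + p.2))) := rfl

/-- The product is distributive (this is all that is needed to iterate the construction). -/
noncomputable instance : NonUnitalNonAssocRing (PDO A d) where
  zero_mul L := by
    ext m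
    simp [coeff_mul]
  mul_zero L := by
    ext m
    simp [coeff_mul, iterate_map_zero]
  left_distrib L M M' := by
    ext m
    rw [coeff_add]
    refine Eq.trans (finsum_congr fun p => ?_)
      (finsum_add_distrib (finite_mulTerm L M m) (finite_mulTerm L M' m))
    simp [mulTerm, iterate_map_add, mul_add]
  right_distrib L L' M := by
    ext m
    rw [coeff_add]
    refine Eq.trans (finsum_congr fun p => ?_)
      (finsum_add_distrib (finite_mulTerm L M m) (finite_mulTerm L' M m))
    simp [mulTerm, add_mul]

/-- An additive map of the coefficients, extended to operators by `∑ aᵢ ∂ⁱ ↦ ∑ e(aᵢ) ∂ⁱ`. -/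
noncomputable def extend (d e : A →+ A) : PDO A d →+ PDO A d :=
  HahnSeries.mapHom (Γ := ℤᵒᵈ) e

@[simp] theorem coeff_extend (e : A →+ A) (L : PDO A d) (i : ℤ) :
    (extend d e L).coeff i = e (L.coeff i) := rfl

end PDO

/-! ### Pseudo-differential operators in several variables -/

/-- `A((∂₁⁻¹))…((∂ₙ⁻¹))` for the maps `d₁, …, dₙ` of `A`. First `∂₁` is adjoined by means of `d₁`;
then `d₂, …, dₙ` are extended coefficientwise and the remaining `∂₂, …, ∂ₙ` are adjoined in turn. For
commuting derivations `dᵢ` of a ring `A` this is the iterated ring of operators. -/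
def IterPDO : (n : ℕ) → (A : Type u) → [NonUnitalNonAssocRing A] → (Fin n → (A →+ A)) → Type u
  | 0, A, _, _ => A
  | n + 1, A, _, d => IterPDO n (PDO A (d 0)) (fun i => PDO.extend (d 0) (d i.succ))

namespace IterPDO

/-- The addition and the product of the iterated construction. -/
noncomputable instance instRing : (n : ℕ) → (A : Type u) → [NonUnitalNonAssocRing A] →
    (d : Fin n → (A →+ A)) → NonUnitalNonAssocRing (IterPDO n A d)
  | 0, _, inst, _ => inst
  | n + 1, A, _, d => instRing n (PDO A (d 0)) (fun i => PDO.extend (d 0) (d i.succ))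

noncomputable instance instModule (k : Type u) [Field k] :
    (n : ℕ) → (A : Type u) → [NonUnitalNonAssocRing A] → [Module k A] →
    (d : Fin n → (A →+ A)) → Module k (IterPDO n A d)
  | 0, _, _, inst, _ => inst
  | n + 1, A, _, _, d => instModule k n (PDO A (d 0)) (fun i => PDO.extend (d 0) (d i.succ))

/-- `coeff n A d L β` is the coefficient `a_β ∈ A` of `∂₁ ^ β₁ ⋯ ∂ₙ ^ βₙ` in `L`. -/
noncomputable def coeff : (n : ℕ) → (A : Type u) → [NonUnitalNonAssocRing A] → (d : Fin n → (A →+ A)) →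
    IterPDO n A d → (Fin n → ℤ) → A
  | 0, _, _, _, L, _ => L
  | n + 1, A, _, d, L, β =>
      PDO.coeff (coeff n (PDO A (d 0)) (fun i => PDO.extend (d 0) (d i.succ)) L (Fin.tail β)) (β 0)

/-- The series `∑ a_β z^β` of an operator `∑ a_β ∂^β`: each `∂ᵢ` is replaced by `zᵢ`. -/
noncomputable def symbol : (n : ℕ) → (A : Type u) → [NonUnitalNonAssocRing A] → (d : Fin n → (A →+ A)) →
    IterPDO n A d → IterHahn ℤᵒᵈ n A
  | 0, _, _, _, L => L
  | n + 1, A, _, d, L => symbol n (PDO A (d 0)) (fun i => PDO.extend (d 0) (d i.succ)) L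

/-- The symbol has the coefficients of the operator. -/
theorem coeff_symbol (n : ℕ) (A : Type u) [NonUnitalNonAssocRing A] (d : Fin n → (A →+ A))
    (L : IterPDO n A d) (β : Fin n → ℤ) :
    IterHahn.coeff n A (symbol n A d L) (fun i => OrderDual.toDual (β i)) = coeff n A d L β := by
  induction n generalizing A with
  | zero => rfl
  | succ n ih =>
    exact congrArg (fun M : PDO A (d 0) => M.coeff (β 0))
      (ih (PDO A (d 0)) (fun i => PDO.extend (d 0) (d i.succ)) L (Fin.tail β))

end IterPDO

/-! ### The rings `P` and `V`, symbols, residues and the pairing -/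

/-- The field `k((x₁))…((xₙ))` of iterated Laurent series. -/
abbrev CoeffField (k : Type u) [Field k] (n : ℕ) : Type u := IterHahn ℤ n k

/-- `P = k((x₁))…((xₙ))((∂₁⁻¹))…((∂ₙ⁻¹))`, where `∂ᵢ` acts on the coefficients by `∂/∂xᵢ`. -/
abbrev PseudoDiffOp (k : Type u) [Field k] (n : ℕ) : Type u :=
  IterPDO n (CoeffField k n) (IterHahn.pderiv n k)

/-- The field of symbols `V = k((x₁))…((xₙ))((z₁⁻¹))…((zₙ⁻¹))`. -/
abbrev SymbolField (k : Type u) [Field k] (n : ℕ) : Type u :=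
  IterHahn ℤᵒᵈ n (CoeffField k n)

section

variable {k : Type u} [Field k] {n : ℕ}

/-- The symbol `σ(L) = ∑ a_β z^β` of `L = ∑ a_β ∂^β`. -/
noncomputable def sigma (L : PseudoDiffOp k n) : SymbolField k n :=
  IterPDO.symbol n (CoeffField k n) (IterHahn.pderiv n k) L

/-- The coefficient of `x^α ∂^β` in an operator. -/
noncomputable def coeffP (L : PseudoDiffOp k n) (α β : Fin n → ℤ) : k :=
  IterHahn.coeff n k (IterPDO.coeff n (CoeffField k n) (IterHahn.pderiv n k) L β) α

/-- The coefficient of `x^α z^β` in a symbol. -/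
noncomputable def coeffV (F : SymbolField k n) (α β : Fin n → ℤ) : k :=
  IterHahn.coeff n k (IterHahn.coeff n (CoeffField k n) F (fun i => OrderDual.toDual (β i))) α

/-- The residue of an operator: the coefficient of `x₁⁻¹ ⋯ xₙ⁻¹ ∂₁⁻¹ ⋯ ∂ₙ⁻¹`. -/
noncomputable def resP (L : PseudoDiffOp k n) : k := coeffP L (fun _ => -1) (fun _ => -1)

/-- The residue of a symbol: the coefficient of `x₁⁻¹ ⋯ xₙ⁻¹ z₁⁻¹ ⋯ zₙ⁻¹`. -/
noncomputable def resV (F : SymbolField k n) : k := coeffV F (fun _ => -1) (fun _ => -1)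

/-- The pairing `⟨L, M⟩ = res_P (L M)`. -/
noncomputable def pairing (L M : PseudoDiffOp k n) : k := resP (L * M)

end

/-!
Let `d` be a derivation of `A` and `τ` a trace on `A` that kills the image of `d`. Integration by
parts gives `τ (a dˡ(b)) = (-1)ˡ τ (dˡ(a) b)`, and the binomial coefficients satisfy
`(l - 1 - i choose l) = (-1)ˡ (i choose l)`. Hence the reflection `i ↦ l - 1 - i` matches the terms
of `τ (res (L M))` with those of `τ (res (M L))`, where `res` is the coefficient of `∂⁻¹`: the map
`τ ∘ res` is a trace on `A((∂⁻¹))`. It kills the images of the derivations of `A` that `τ` kills,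
extended coefficientwise, so that the argument can be iterated. It starts from the coefficient of
`x₁⁻¹ ⋯ xₙ⁻¹`, which vanishes on every partial derivative.

Nondegeneracy climbs the same tower: if `L` has the leading term `a ∂ᵐ`, then
`res (L b ∂⁻¹⁻ᵐ) = a b`.
-/

/-! ### Traces and integration by parts -/

/-- The product rule. Mathlib's `Derivation` requires a commutative algebra as its domain, which
`PDO A d` is not. -/
def IsLeibniz {A : Type*} [Mul A] [Add A] (D : A → A) : Prop :=
  ∀ a b, D (a * b) = D a * b + a * D b

/-- A trace: a map that does not see the order of the factors of a product. -/
def IsTrace {A K : Type*} [Mul A] (τ : A → K) : Prop :=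
  ∀ a b, τ (a * b) = τ (b * a)

/-- The pairing `(a, b) ↦ τ (a * b)` has no nonzero left annihilator. -/
def IsMulSeparating {A K : Type*} [Mul A] [Zero A] [Zero K] (τ : A → K) : Prop :=
  ∀ a, (∀ b, τ (a * b) = 0) → a = 0

theorem isMulSeparating_of_apply_ne_zero {A K : Type*} [GroupWithZero A] [Zero K] {τ : A → K}
    {x : A} (hx : τ x ≠ 0) : IsMulSeparating τ := by
  intro a h
  by_contra ha
  exact hx (by simpa only [mul_inv_cancel_left₀ ha] using h (a⁻¹ * x))

namespace IsTrace

variable {k A : Type*} [CommSemiring k] [NonUnitalNonAssocSemiring A] [Module k A]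
  [IsScalarTower k A A] {τ : A →ₗ[k] k}

/-- The pairing `(a, b) ↦ τ (a * b)`. Its linearity in `b` is inherited from the linearity in `a`
by the trace property, since the product of `A` is only assumed linear in the first factor. -/
def bilinForm (hτ : IsTrace τ) : LinearMap.BilinForm k A :=
  LinearMap.mk₂ k (fun a b => τ (a * b))
    (fun a a' b => by rw [add_mul, map_add])
    (fun c a b => by rw [smul_mul_assoc, map_smul])
    (fun a b b' => by rw [mul_add, map_add])
    (fun c a b => by rw [hτ a, smul_mul_assoc, map_smul, hτ b])

theorem nondegenerate_bilinForm (hτ : IsTrace τ) (hsep : IsMulSeparating τ) :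
    hτ.bilinForm.Nondegenerate :=
  ⟨hsep, fun b hb => hsep b fun a => (hτ b a).trans (hb a)⟩

end IsTrace

theorem IsLeibniz.map_mul_iterate {A K : Type*} [NonUnitalNonAssocRing A] [AddCommGroup K]
    {d : A →+ A} (hd : IsLeibniz d) {τ : A →+ K} (hτd : ∀ a, τ (d a) = 0) (l : ℕ) (a b : A) :
    τ (a * d^[l] b) = (-1 : ℤ) ^ l • τ (d^[l] a * b) := by
  induction l generalizing a with
  | zero => simp
  | succ l ih =>
    have parts : τ (d a * d^[l] b) + τ (a * d (d^[l] b)) = 0 := by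
      rw [← map_add, ← hd, hτd]
    rw [Function.iterate_succ_apply', Function.iterate_succ_apply,
      eq_neg_of_add_eq_zero_right parts, ih, pow_succ, mul_neg_one, neg_smul]

theorem choose_natCast_sub_one_sub (i : ℤ) (l : ℕ) :
    Ring.choose (l - 1 - i) l = (-1) ^ l * Ring.choose i l := by
  rw [show (l : ℤ) - 1 - i = -(i + 1 - l) by ring, Ring.choose_neg,
    show i + 1 - l + l - 1 = i by ring, Int.negOnePow_def, zpow_natCast, Units.smul_def]
  simp

/-! ### Residues of operators -/

namespace PDO

variable {A : Type u} [NonUnitalNonAssocRing A] {d : A →+ A}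

/-- The coefficient of `∂ⁱ` as an additive map. -/
def coeffHom (d : A →+ A) (i : ℤ) : PDO A d →+ A where
  toFun L := L.coeff i
  map_zero' := rfl
  map_add' _ _ := rfl

/-- The operator `b ∂ʲ`. -/
noncomputable def monomial (d : A →+ A) (j : ℤ) (b : A) : PDO A d :=
  HahnSeries.single (OrderDual.toDual j) b

theorem coeff_monomial (i j : ℤ) (b : A) :
    (monomial d j b).coeff i = if i = j then b else 0 := by
  simp [monomial, coeff, HahnSeries.coeff_single]

theorem coeff_mul_eq_finsum (L M : PDO A d) (m : ℤ) :
    (L * M).coeff m = ∑ᶠ p, mulTerm L M m p :=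
  rfl

theorem map_coeff_mul {K : Type*} [AddCommMonoid K] (f : A →+ K) (L M : PDO A d) (m : ℤ) :
    f ((L * M).coeff m) = ∑ᶠ p, f (mulTerm L M m p) :=
  f.map_finsum (finite_mulTerm L M m)

instance instIsScalarTower {k : Type u} [Field k] [Module k A] [IsScalarTower k A A] :
    IsScalarTower k (PDO A d) (PDO A d) where
  smul_assoc c L M := by
    ext m
    rw [smul_eq_mul, smul_eq_mul, coeff_smul, coeff_mul_eq_finsum, coeff_mul_eq_finsum,
      smul_finsum' c (finite_mulTerm L M m)]
    refine finsum_congr fun p => ?_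
    rw [mulTerm, mulTerm, coeff_smul, smul_mul_assoc, smul_comm]

theorem isLeibniz_extend {e : A →+ A} (he : IsLeibniz e) (h : Function.Commute e d) :
    IsLeibniz (extend d e) := by
  intro L M
  ext m
  rw [coeff_extend, coeff_add, map_coeff_mul, coeff_mul_eq_finsum, coeff_mul_eq_finsum,
    ← finsum_add_distrib (finite_mulTerm _ _ _) (finite_mulTerm _ _ _)]
  refine finsum_congr fun p => ?_
  simp only [mulTerm, map_zsmul, he _ _, smul_add, coeff_extend, (h.iterate_right p.2).eq]

theorem commute_extend {e e' : A →+ A} (h : Function.Commute e e') :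
    Function.Commute (extend d e) (extend d e') :=
  fun L => PDO.ext fun i => h (L.coeff i)

/-- The involution `(i, l) ↦ (l - 1 - i, l)`: if the terms `a ∂ⁱ` of `L` and `b ∂ʲ` of `M`
contribute to the coefficient of `∂⁻¹` in `L * M` through `dˡ b`, then `j = l - 1 - i`. -/
def residueReflection : Equiv.Perm (ℤ × ℕ) :=
  Function.Involutive.toPerm (fun p => (p.2 - 1 - p.1, p.2)) fun p => by simp

theorem map_mulTerm_residueReflection {K : Type*} [AddCommGroup K] (hd : IsLeibniz d)
    {τ : A →+ K} (hτd : ∀ a, τ (d a) = 0) (hτ : IsTrace τ) (L M : PDO A d) (p : ℤ × ℕ) :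
    τ (mulTerm M L (-1) (residueReflection p)) = τ (mulTerm L M (-1) p) := by
  obtain ⟨i, l⟩ := p
  change τ (Ring.choose ((l : ℤ) - 1 - i) l •
      (M.coeff (l - 1 - i) * d^[l] (L.coeff (-1 - (l - 1 - i) + l)))) =
    τ (Ring.choose i l • (L.coeff i * d^[l] (M.coeff (-1 - i + l))))
  rw [show -1 - ((l : ℤ) - 1 - i) + l = i by ring, show -1 - i + (l : ℤ) = l - 1 - i by ring,
    map_zsmul, map_zsmul, choose_natCast_sub_one_sub, hd.map_mul_iterate hτd l (L.coeff i),
    hτ (d^[l] (L.coeff i)), mul_comm ((-1) ^ l), mul_smul]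

theorem isTrace_residue {K : Type*} [AddCommGroup K] (hd : IsLeibniz d) {τ : A →+ K}
    (hτd : ∀ a, τ (d a) = 0) (hτ : IsTrace τ) : IsTrace (τ.comp (coeffHom d (-1))) := by
  intro L M
  change τ ((L * M).coeff (-1)) = τ ((M * L).coeff (-1))
  rw [map_coeff_mul, map_coeff_mul, ← finsum_comp_equiv residueReflection]
  exact finsum_congr (map_mulTerm_residueReflection hd hτd hτ M L)

theorem exists_leading_coeff {L : PDO A d} (hL : L ≠ 0) :
    ∃ m, L.coeff m ≠ 0 ∧ ∀ i, m < i → L.coeff i = 0 :=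
  ⟨OrderDual.ofDual (HahnSeries.order (Γ := ℤᵒᵈ) L),
    mt HahnSeries.coeff_order_eq_zero.mp hL,
    fun _ hi => HahnSeries.coeff_eq_zero_of_lt_order (Γ := ℤᵒᵈ) hi⟩

theorem coeff_mul_monomial_of_leading {L : PDO A d} {m : ℤ} (hm : ∀ i, m < i → L.coeff i = 0)
    (j : ℤ) (b : A) : (L * monomial d j b).coeff (m + j) = L.coeff m * b := by
  rw [coeff_mul, finsum_eq_single _ (m, 0)]
  · simp [coeff_monomial]
  · rintro ⟨i, l⟩ hp
    rcases lt_or_ge m i with hi | hi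
    · simp [hm i hi]
    · have hne : m + j - i + (l : ℤ) ≠ j := fun h => hp (by ext <;> simp <;> omega)
      simp [coeff_monomial, hne, iterate_map_zero]

theorem isMulSeparating_residue {K : Type*} [Zero K] {τ : A → K} (hτ : IsMulSeparating τ) :
    IsMulSeparating fun L : PDO A d => τ (L.coeff (-1)) := by
  intro L h
  by_contra hL
  obtain ⟨m, hm, hlead⟩ := exists_leading_coeff hL
  refine hm (hτ _ fun b => ?_)
  rw [← coeff_mul_monomial_of_leading hlead (-1 - m) b, add_sub_cancel]
  exact h _

end PDO

namespace IterPDO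

instance instIsScalarTower (k : Type u) [Field k] : (n : ℕ) → (A : Type u) →
    [NonUnitalNonAssocRing A] → [Module k A] → [IsScalarTower k A A] → (d : Fin n → (A →+ A)) →
    IsScalarTower k (IterPDO n A d) (IterPDO n A d)
  | 0, _, _, _, inst, _ => inst
  | n + 1, A, _, _, _, d =>
      instIsScalarTower k n (PDO A (d 0)) (fun i => PDO.extend (d 0) (d i.succ))

variable {n : ℕ} {A : Type u} [NonUnitalNonAssocRing A]

/-- The residue of operators relative to a map `τ` of the coefficients: `τ` of the coefficient of
`∂₁⁻¹ ⋯ ∂ₙ⁻¹`. -/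
noncomputable def residue {K : Type*} (d : Fin n → (A →+ A)) (τ : A → K) (L : IterPDO n A d) : K :=
  τ (coeff n A d L fun _ => -1)

theorem isLinearMap_coeff {k : Type u} [Field k] [Module k A] (d : Fin n → (A →+ A))
    (β : Fin n → ℤ) : IsLinearMap k fun L : IterPDO n A d => coeff n A d L β := by
  induction n generalizing A with
  | zero => exact LinearMap.id.isLinear
  | succ n ih =>
    have h := ih (A := PDO A (d 0)) (fun i => PDO.extend (d 0) (d i.succ)) (Fin.tail β)
    exact ⟨fun L M => congrArg (PDO.coeff · (β 0)) (h.map_add L M),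
      fun c L => congrArg (PDO.coeff · (β 0)) (h.map_smul c L)⟩

theorem isLinearMap_residue {k : Type u} [Field k] [Module k A] {K : Type*} [AddCommMonoid K]
    [Module k K] (d : Fin n → (A →+ A)) (τ : A →ₗ[k] K) : IsLinearMap k (residue d τ) :=
  (τ ∘ₗ (isLinearMap_coeff d fun _ => -1).mk' _).isLinear

theorem isTrace_residue {K : Type*} [AddCommGroup K] {d : Fin n → (A →+ A)}
    (hd : ∀ i, IsLeibniz (d i)) (hcomm : ∀ i j, Function.Commute (d i) (d j)) {τ : A →+ K}
    (hτd : ∀ i a, τ (d i a) = 0) (hτ : IsTrace τ) : IsTrace (residue d τ) := by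
  induction n generalizing A with
  | zero => exact hτ
  | succ n ih =>
    exact ih (fun i => PDO.isLeibniz_extend (hd i.succ) (hcomm _ _))
      (fun i j => PDO.commute_extend (hcomm i.succ j.succ)) (fun i L => hτd i.succ (L.coeff (-1)))
      (PDO.isTrace_residue (hd 0) (hτd 0) hτ)

theorem isMulSeparating_residue {K : Type*} [Zero K] (d : Fin n → (A →+ A)) {τ : A → K}
    (hτ : IsMulSeparating τ) : IsMulSeparating (residue d τ) := by
  induction n generalizing A with
  | zero => exact hτ
  | succ n ih =>
    exact ih (fun i => PDO.extend (d 0) (d i.succ)) (PDO.isMulSeparating_residue hτ)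

end IterPDO

/-! ### Laurent series -/

section HahnSeries

variable {Γ : Type*} [AddCommMonoid Γ] [PartialOrder Γ] [IsOrderedCancelAddMonoid Γ]

theorem isLeibniz_of_coeff {A : Type*} [NonUnitalNonAssocSemiring A]
    {D : HahnSeries Γ A → HahnSeries Γ A} (f : Γ → A →+ A)
    (hD : ∀ x i, (D x).coeff i = f i (x.coeff i))
    (hf : ∀ i j a b, f (i + j) (a * b) = f i a * b + a * f j b) : IsLeibniz D := by
  have support_subset (x : HahnSeries Γ A) : (D x).support ⊆ x.support := by
    intro i hi h
    exact hi (by rw [hD, h, map_zero])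
  intro x y
  ext g
  rw [HahnSeries.coeff_add, HahnSeries.coeff_mul_left' x.isPWO_support (support_subset x),
    HahnSeries.coeff_mul_right' y.isPWO_support (support_subset y), hD, HahnSeries.coeff_mul,
    map_sum, ← Finset.sum_add_distrib]
  refine Finset.sum_congr rfl fun p hp => ?_
  rw [← (Finset.mem_antidiagonal.mp hp).2.2, hf, hD, hD]

instance instIsScalarTowerHahnSeriesSelf {k A : Type*} [NonUnitalNonAssocSemiring A]
    [DistribSMul k A] [IsScalarTower k A A] :
    IsScalarTower k (HahnSeries Γ A) (HahnSeries Γ A) where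
  smul_assoc c x y := by
    have support_subset : (c • x).support ⊆ x.support := HahnSeries.support_smul_subset c x
    ext g
    simp only [smul_eq_mul, HahnSeries.coeff_smul, HahnSeries.coeff_mul,
      HahnSeries.coeff_mul_left' x.isPWO_support support_subset, smul_mul_assoc, Finset.smul_sum]

end HahnSeries

theorem isLeibniz_mapHom {Γ : Type} [AddCommMonoid Γ] [LinearOrder Γ] [IsOrderedCancelAddMonoid Γ]
    {A : Type u} [NonUnitalNonAssocRing A] {e : A →+ A} (he : IsLeibniz e) :
    IsLeibniz (HahnSeries.mapHom e : HahnSeries Γ A →+ HahnSeries Γ A) :=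
  isLeibniz_of_coeff (fun _ => e) (fun _ _ => rfl) fun _ _ => he

theorem coeff_laurentDerivative {R V : Type*} [Semiring R] [AddCommGroup V] [Module R V]
    (x : LaurentSeries V) (i : ℤ) :
    (LaurentSeries.derivative R x).coeff i = (i + 1) • x.coeff (i + 1) := by
  simp [LaurentSeries.derivative_apply, LaurentSeries.hasseDeriv_coeff]

/- The Euler operator `X d/dX` multiplies each coefficient by its exponent, so it satisfies the
product rule coefficientwise; `X` is then cancelled. -/
theorem isLeibniz_laurentDerivative (A : Type*) [CommRing A] :
    IsLeibniz (LaurentSeries.derivative A (V := A)) := by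
  let X : LaurentSeries A := HahnSeries.single 1 1
  have euler : IsLeibniz fun x : LaurentSeries A => X * LaurentSeries.derivative A x := by
    refine isLeibniz_of_coeff (fun i => DistribSMul.toAddMonoidHom A i) (fun x i => ?_)
      fun i j a b => ?_
    · simp [X, HahnSeries.coeff_single_mul]
    · simp [add_mul, mul_add, mul_assoc, mul_left_comm]
  intro x y
  have isUnit_X : IsUnit X := .of_mul_eq_one (HahnSeries.single (-1) 1) (by simp [X])
  exact isUnit_X.mul_left_cancel ((euler x y).trans (by ring))

namespace IterHahn

theorem ext_coeff {Γ : Type} [LinearOrder Γ] {n : ℕ} {A : Type u} [Zero A] {x y : IterHahn Γ n A}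
    (h : ∀ α, coeff n A x α = coeff n A y α) : x = y := by
  induction n generalizing A with
  | zero => exact h Fin.elim0
  | succ n ih =>
    exact ih (A := HahnSeries Γ A) fun α => HahnSeries.ext (funext fun g => h (Fin.cons g α))

theorem coeff_surjective {Γ : Type} [LinearOrder Γ] {n : ℕ} {A : Type u} [Zero A] (α : Fin n → Γ) :
    Function.Surjective fun x : IterHahn Γ n A => coeff n A x α := by
  intro a
  induction n generalizing A with
  | zero => exact ⟨a, rfl⟩
  | succ n ih =>
    obtain ⟨x, hx⟩ := ih (Fin.tail α) (HahnSeries.single (α 0) a)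
    exact ⟨x, (congrArg (HahnSeries.coeff · (α 0)) hx).trans (HahnSeries.coeff_single_same _ _)⟩

section Module

variable {Γ : Type} [AddCommGroup Γ] [LinearOrder Γ] [IsOrderedAddMonoid Γ]

instance instIsScalarTower (k : Type u) [Field k] : (n : ℕ) → (A : Type u) → [Field A] →
    [Module k A] → [IsScalarTower k A A] → IsScalarTower k (IterHahn Γ n A) (IterHahn Γ n A)
  | 0, _, _, _, inst => inst
  | n + 1, A, _, _, _ => instIsScalarTower k n (HahnSeries Γ A)

theorem isLinearMap_coeff {k : Type u} [Field k] {n : ℕ} {A : Type u} [Field A] [Module k A]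
    (α : Fin n → Γ) : IsLinearMap k fun x : IterHahn Γ n A => coeff n A x α := by
  induction n generalizing A with
  | zero => exact LinearMap.id.isLinear
  | succ n ih =>
    have h := ih (A := HahnSeries Γ A) (Fin.tail α)
    exact ⟨fun x y => congrArg (HahnSeries.coeff · (α 0)) (h.map_add x y),
      fun c x => congrArg (HahnSeries.coeff · (α 0)) (h.map_smul c x)⟩

/-- The coefficient of `x ^ α` as a map linear over the constants. -/
noncomputable def lcoeff (k : Type u) [Field k] {n : ℕ} {A : Type u} [Field A] [Module k A]
    (α : Fin n → Γ) : IterHahn Γ n A →ₗ[k] A :=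
  (isLinearMap_coeff α).mk' _

end Module

theorem coeff_map {n : ℕ} {A B : Type u} [Field A] [Field B] (f : A →+ B) (x : IterHahn ℤ n A)
    (α : Fin n → ℤ) : coeff n B (map n f x) α = f (coeff n A x α) := by
  induction n generalizing A B with
  | zero => rfl
  | succ n ih =>
    exact congrArg (HahnSeries.coeff · (α 0))
      (ih (A := HahnSeries ℤ A) (B := HahnSeries ℤ B) (HahnSeries.mapHom f) x (Fin.tail α))

theorem isLeibniz_map {n : ℕ} {A : Type u} [Field A] {f : A →+ A} (hf : IsLeibniz f) :
    IsLeibniz (map n f) := by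
  induction n generalizing A with
  | zero => exact hf
  | succ _ ih => exact ih (A := HahnSeries ℤ A) (isLeibniz_mapHom hf)

variable {n : ℕ} {A : Type u} [Field A]

theorem isLeibniz_pderiv (i : Fin n) : IsLeibniz (pderiv n A i) := by
  induction n generalizing A with
  | zero => exact i.elim0
  | succ n ih =>
    cases i using Fin.cases with
    | zero => exact isLeibniz_map (isLeibniz_laurentDerivative A)
    | succ i => exact ih (A := HahnSeries ℤ A) i

theorem coeff_pderiv (i : Fin n) (x : IterHahn ℤ n A) (α : Fin n → ℤ) :
    coeff n A (pderiv n A i x) α =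
      (α i + 1) • coeff n A x (Function.update α i (α i + 1)) := by
  induction n generalizing A with
  | zero => exact i.elim0
  | succ n ih =>
    cases i using Fin.cases with
    | zero =>
      have h := coeff_map (LaurentSeries.derivative A (V := A)).toAddMonoidHom x (Fin.tail α)
      refine (congrArg (HahnSeries.coeff · (α 0)) h).trans ?_
      refine (coeff_laurentDerivative (R := A) _ _).trans ?_
      simp [coeff]
    | succ i =>
      have h := ih (A := HahnSeries ℤ A) i x (Fin.tail α)
      refine (congrArg (HahnSeries.coeff · (α 0)) h).trans ?_
      simp only [coeff, HahnSeries.coeff_smul, Fin.tail,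
        Function.update_of_ne i.succ_ne_zero.symm]
      congr 3
      ext j
      simp [Function.update_apply]

theorem commute_pderiv (i j : Fin n) : Function.Commute (pderiv n A i) (pderiv n A j) := by
  rcases eq_or_ne i j with rfl | hij
  · exact Function.Commute.refl _
  refine fun x => ext_coeff fun α => ?_
  simp only [coeff_pderiv, Function.update_of_ne hij, Function.update_of_ne hij.symm]
  rw [smul_comm, Function.update_comm hij]

theorem coeff_pderiv_eq_zero {i : Fin n} {α : Fin n → ℤ} (hα : α i = -1) (x : IterHahn ℤ n A) :
    coeff n A (pderiv n A i x) α = 0 := by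
  rw [coeff_pderiv, hα, neg_add_cancel, zero_smul]

theorem isMulSeparating_coeff (α : Fin n → ℤ) :
    IsMulSeparating fun x : IterHahn ℤ n A => coeff n A x α := by
  obtain ⟨x, hx⟩ := coeff_surjective α (1 : A)
  exact isMulSeparating_of_apply_ne_zero (x := x) (hx.trans_ne one_ne_zero)

end IterHahn

theorem proposition2_general {k A : Type u} [Field k] [NonUnitalNonAssocRing A] [Module k A]
    [IsScalarTower k A A] {n : ℕ} {d : Fin n → (A →+ A)} (hd : ∀ i, IsLeibniz (d i))
    (hcomm : ∀ i j, Function.Commute (d i) (d j)) {τ : A →ₗ[k] k} (hτd : ∀ i a, τ (d i a) = 0)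
    (hτ : IsTrace τ) (hsep : IsMulSeparating τ) :
    (IsLinearMap k (IterPDO.residue d τ) ∧ ∀ L : IterPDO n A d, IterPDO.residue d τ L =
      τ (IterHahn.coeff n A (IterPDO.symbol n A d L) fun _ => OrderDual.toDual (-1))) ∧
    (∀ L M : IterPDO n A d, IterPDO.residue d τ (L * M - M * L) = 0) ∧
    (∃ B : LinearMap.BilinForm k (IterPDO n A d),
      (∀ L M : IterPDO n A d, B L M = IterPDO.residue d τ (L * M)) ∧ B.Nondegenerate) := by
  have hlin := IterPDO.isLinearMap_residue d τ
  have htrace : IsTrace (hlin.mk' _) :=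
    IterPDO.isTrace_residue hd hcomm (τ := τ.toAddMonoidHom) hτd hτ
  refine ⟨⟨hlin, fun L => ?_⟩, fun L M => ?_, htrace.bilinForm, fun _ _ => rfl,
    htrace.nondegenerate_bilinForm (IterPDO.isMulSeparating_residue d hsep)⟩
  · exact congrArg τ (IterPDO.coeff_symbol n A d L fun _ => -1).symm
  · exact (hlin.map_sub _ _).trans (sub_eq_zero.mpr (htrace L M))

theorem proposition2 (k : Type u) [Field k] (n : ℕ) :
    (IsLinearMap k (resP : PseudoDiffOp k n → k) ∧
      ∀ L : PseudoDiffOp k n, resP L = resV (sigma L)) ∧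
    (∀ L M : PseudoDiffOp k n, resP (L * M - M * L) = 0) ∧
    (∃ B : LinearMap.BilinForm k (PseudoDiffOp k n),
      (∀ L M : PseudoDiffOp k n, B L M = pairing L M) ∧ B.Nondegenerate) :=
  proposition2_general (τ := IterHahn.lcoeff k (A := k) fun _ => -1) IterHahn.isLeibniz_pderiv
    IterHahn.commute_pderiv (fun _ => IterHahn.coeff_pderiv_eq_zero rfl)
    (fun x y => by rw [mul_comm]) (IterHahn.isMulSeparating_coeff _)
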